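/- Let $r \ge 2$ and let $H=(V,E)$ be an $r$-uniform hypergraph on a finite vertex set $V$, that is, $E$ is a set of $r$-element subsets of $V$; write $e=|E|$. The adjacency tensor of $H$ is $A=(a_{i_1\cdots i_r})_{i_1,\dots,i_r\in V}$ with $a_{i_1\cdots i_r}=\frac{1}{(r-1)!}$ if $\{i_1,\dots,i_r\}\in E$ and $a_{i_1\cdots i_r}=0$ otherwise. The spectral radius of $H$ is $$\rho(H)=\max_{\|x\|_r=1}\ \sum_{i_1,\dots,i_r\in V} a_{i_1\cdots i_r}x_{i_1}\cdots x_{i_r},\qquad x\in\mathbb{R}^V,\quad \|x\|_r=\Big(\sum_{v\in V}|x_v|^r\Big)^{1/r}$$ (equivalently, the largest modulus of a complex eigenvalue of $A$; for $V=\emptyset$ put $\rho(H)=0$). Let $p_r(x)=\frac{x(x-1)\cdots(x-r+1)}{r!}$, let $p_r^{-1}\colon[0,\infty)\to[r-1,\infty)$ be the inverse function of the restriction of $p_r$ to $[r-1,\infty)$, and let $f_r(x)=p_{r-1}\big(p_r^{-1}(x)-1\big)$ for $x\ge 0$, so that $f_r\big(\binom{k}{r}\big)=\binom{k-1}{r-1}$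 for all integers $k\ge r-1$. Then $\rho(H)\le f_r(e)$. Moreover, $\rho(H)=f_r(e)$ if and only if there is an integer $k \ge 0$ such that $e=\binom{k}{r}$ and $H$ is the complete $r$-uniform hypergraph $K_k^r$ on $k$ of its vertices, possibly together with some isolated vertices. -/

import Mathlib

/-! ### Uniform hypergraphs and their adjacency tensors -/

/-- An `r`-uniform hypergraph with vertex set `V`: a set of `r`-element subsets of `V`. -/
structure UniformHypergraph (V : Type*) (r : ℕ) where
  /-- The edges. -/
  edges : Finset (Finset V)
  /-- Every edge has exactly `r` vertices. -/
  card_of_mem : ∀ e ∈ edges, e.card = r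

namespace UniformHypergraph

/-- The adjacency tensor of an `r`-uniform hypergraph: the entry at `(i₁, …, i_r)` is
`1 / (r - 1)!` if `{i₁, …, i_r}` is an edge, and `0` otherwise. -/
noncomputable def adjTensor {V : Type*} [DecidableEq V] {r : ℕ} (H : UniformHypergraph V r)
    (i : Fin r → V) : ℝ :=
  if Finset.univ.image i ∈ H.edges then 1 / ((r - 1).factorial : ℝ) else 0

/-- The polynomial form `P_H(x) = ∑_{i₁, …, i_r} a_{i₁ ⋯ i_r} x_{i₁} ⋯ x_{i_r}`. -/
noncomputable def polyForm {V : Type*} [Fintype V] [DecidableEq V] {r : ℕ}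
    (H : UniformHypergraph V r) (x : V → ℝ) : ℝ :=
  ∑ i : Fin r → V, H.adjTensor i * ∏ j, x (i j)

/-- The norm `‖x‖_r = (∑ |x_v| ^ r) ^ (1 / r)`. -/
noncomputable def rNorm {V : Type*} [Fintype V] (r : ℕ) (x : V → ℝ) : ℝ :=
  (∑ v, |x v| ^ r) ^ (1 / (r : ℝ))

/-- The spectral radius `ρ(H) = max_{‖x‖_r = 1} P_H(x)`. The lemmas `isGreatest_spectralRadius`
and `isGreatest_norm_eigenvalue` below show that the maximum is attained and that it is the largest
modulus of the complex eigenvalues of the adjacency tensor. -/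
noncomputable def spectralRadius {V : Type*} [Fintype V] [DecidableEq V] {r : ℕ}
    (H : UniformHypergraph V r) : ℝ :=
  sSup {p : ℝ | ∃ x : V → ℝ, rNorm r x = 1 ∧ p = H.polyForm x}

/-- `H` is the complete `r`-uniform hypergraph on `k` of its vertices, all its other vertices being
isolated. -/
def IsCompleteWithIsolated {V : Type*} {r : ℕ} (H : UniformHypergraph V r) (k : ℕ) : Prop :=
  ∃ S : Finset V, S.card = k ∧ H.edges = S.powersetCard r

/-- `lam` is an eigenvalue of the adjacency tensor: some nonzero complex vector `x` satisfies
`∑_{i₂, …, i_r} a_{v i₂ ⋯ i_r} x_{i₂} ⋯ x_{i_r} = lam * x_v ^ (r - 1)` for every `v`. -/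
def IsEigenvalue {V : Type*} [Fintype V] [DecidableEq V] {r : ℕ} [NeZero r]
    (H : UniformHypergraph V r) (lam : ℂ) : Prop :=
  ∃ x : V → ℂ, x ≠ 0 ∧ ∀ v, ∑ i : Fin r → V with i 0 = v,
    (H.adjTensor i : ℂ) * ∏ j ∈ Finset.univ.erase 0, x (i j) = lam * x v ^ (r - 1)

end UniformHypergraph

/-! ### The function `f_r` -/

/-- The polynomial `p_r(x) = x (x - 1) ⋯ (x - r + 1) / r!`. -/
noncomputable def binomPoly (r : ℕ) (x : ℝ) : ℝ :=
  (∏ j ∈ Finset.range r, (x - j)) / (r.factorial : ℝ)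

/-- The inverse function `p_r⁻¹ : [0, ∞) → [r - 1, ∞)` of `p_r` restricted to `[r - 1, ∞)`;
`bijOn_binomPoly` below shows that it exists. -/
noncomputable def binomPolyInv (r : ℕ) : ℝ → ℝ :=
  Function.invFunOn (binomPoly r) (Set.Ici ((r : ℝ) - 1))

/-- The function `f_r(x) = p_{r-1}(p_r⁻¹(x) - 1)` on `[0, ∞)`. -/
noncomputable def stanleyF (r : ℕ) (x : ℝ) : ℝ :=
  binomPoly (r - 1) (binomPolyInv r x - 1)

/-- `p_r(n)` is the binomial coefficient. -/
theorem binomPoly_natCast (r n : ℕ) : binomPoly r n = n.choose r := by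
  rw [binomPoly, div_eq_iff (by positivity)]
  have h := descPochhammer_eval_eq_prod_range (R := ℝ) r (n : ℝ)
  rw [← h, descPochhammer_eval_eq_descFactorial, Nat.descFactorial_eq_factorial_mul_choose]
  push_cast; ring

theorem strictMonoOn_binomPoly {r : ℕ} (hr : 1 ≤ r) :
    StrictMonoOn (binomPoly r) (Set.Ici ((r : ℝ) - 1)) := by
  intro a ha b hb hab
  simp only [Set.mem_Ici] at ha hb
  unfold binomPoly
  refine div_lt_div_of_pos_right ?_ (by positivity)
  have hj : ∀ j ∈ Finset.range r, (j : ℝ) ≤ r - 1 := by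
    intro j hj
    have : j + 1 ≤ r := Finset.mem_range.1 hj
    have : ((j + 1 : ℕ) : ℝ) ≤ r := by exact_mod_cast this
    push_cast at this; linarith
  by_cases h0 : a = (r : ℝ) - 1
  · have : ∏ j ∈ Finset.range r, (a - j) = 0 := by
      refine Finset.prod_eq_zero (i := r - 1) (Finset.mem_range.2 (by omega)) ?_
      rw [h0, Nat.cast_sub hr]; simp
    rw [this]
    refine Finset.prod_pos fun j h => ?_
    have := hj j h; linarith
  · have ha' : (r : ℝ) - 1 < a := lt_of_le_of_ne ha (Ne.symm h0)
    refine Finset.prod_lt_prod_of_nonempty ?_ ?_ ⟨0, Finset.mem_range.2 (by omega)⟩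
    · intro j h; have := hj j h; linarith
    · intro j h; linarith

/-- `p_r` is a bijection from `[r - 1, ∞)` onto `[0, ∞)`. -/
theorem bijOn_binomPoly {r : ℕ} (hr : 1 ≤ r) :
    Set.BijOn (binomPoly r) (Set.Ici ((r : ℝ) - 1)) (Set.Ici 0) := by
  have hm := strictMonoOn_binomPoly hr
  have h0 : binomPoly r ((r : ℝ) - 1) = 0 := by
    unfold binomPoly
    rw [Finset.prod_eq_zero (i := r - 1) (Finset.mem_range.2 (by omega))]
    · simp
    · rw [Nat.cast_sub hr]; simp
  have hc : Continuous (binomPoly r) := by unfold binomPoly; fun_prop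
  refine ⟨fun x hx => ?_, hm.injOn, fun y hy => ?_⟩
  · rw [Set.mem_Ici, ← h0]
    exact hm.monotoneOn Set.self_mem_Ici hx hx
  · simp only [Set.mem_Ici] at hy
    have hbig : y ≤ binomPoly r ((r : ℝ) - 1 + (r.factorial * y + 1)) := by
      unfold binomPoly
      rw [le_div_iff₀ (by positivity)]
      set t : ℝ := r.factorial * y + 1 with ht
      have ht1 : 1 ≤ t := by have : 0 ≤ (r.factorial : ℝ) * y := by positivity
                             linarith
      have h1 : t ^ r ≤ ∏ j ∈ Finset.range r, ((r : ℝ) - 1 + t - j) := by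
        calc t ^ r = ∏ j ∈ Finset.range r, t := by simp
          _ ≤ _ := by
            refine Finset.prod_le_prod (fun _ _ => by linarith) fun j hj => ?_
            have : j + 1 ≤ r := Finset.mem_range.1 hj
            have : ((j + 1 : ℕ) : ℝ) ≤ r := by exact_mod_cast this
            push_cast at this; linarith
      have h2 : t ≤ t ^ r := le_self_pow₀ ht1 (by omega)
      nlinarith
    have hle : (r : ℝ) - 1 ≤ (r : ℝ) - 1 + (r.factorial * y + 1) := by
      have : 0 ≤ (r.factorial : ℝ) * y := by positivity
      linarith
    obtain ⟨x, hx, hxy⟩ := intermediate_value_Icc hle hc.continuousOn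
      (show y ∈ Set.Icc _ _ from ⟨by rw [h0]; exact hy, hbig⟩)
    exact ⟨x, hx.1, hxy⟩

theorem binomPolyInv_binomPoly {r : ℕ} (hr : 1 ≤ r) {s : ℝ} (hs : (r : ℝ) - 1 ≤ s) :
    binomPolyInv r (binomPoly r s) = s :=
  (bijOn_binomPoly hr).injOn.leftInvOn_invFunOn hs

/-- `f_r(C(k, r)) = C(k - 1, r - 1)`. -/
theorem stanleyF_choose {r k : ℕ} (hr : 2 ≤ r) (hk : r ≤ k + 1) :
    stanleyF r (k.choose r) = (k - 1).choose (r - 1) := by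
  have h : (r : ℝ) ≤ k + 1 := by exact_mod_cast hk
  rw [stanleyF, ← binomPoly_natCast, binomPolyInv_binomPoly (by omega) (by linarith),
    ← binomPoly_natCast, Nat.cast_sub (by omega : 1 ≤ k), Nat.cast_one]

/-- `f_2(x) = (√(8 x + 1) - 1) / 2`. -/
theorem stanleyF_two {x : ℝ} (hx : 0 ≤ x) : stanleyF 2 x = (√(8 * x + 1) - 1) / 2 := by
  have hs : √(8 * x + 1) ^ 2 = 8 * x + 1 := Real.sq_sqrt (by linarith)
  have h1 : 1 ≤ √(8 * x + 1) := Real.one_le_sqrt.2 (by linarith)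
  have : x = binomPoly 2 ((√(8 * x + 1) + 1) / 2) := by
    simp [binomPoly, Finset.prod_range_succ]; nlinarith
  have h2 : binomPolyInv 2 x = (√(8 * x + 1) + 1) / 2 := by
    conv_lhs => rw [this]
    exact binomPolyInv_binomPoly (by norm_num) (by push_cast; linarith)
  rw [stanleyF, h2]
  simp [binomPoly]; ring

/-! ### The two descriptions of the spectral radius agree -/

namespace UniformHypergraph

theorem image_cons_eq_iff {V : Type*} [DecidableEq V] {s : ℕ} {e : Finset V}
    (he : e.card = s + 1) (v : V) (j : Fin s → V) :
    Finset.univ.image (Fin.cons v j : Fin (s + 1) → V) = e ↔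
      v ∈ e ∧ Finset.univ.image j = e.erase v := by
  have h1 : Finset.univ.image (Fin.cons v j : Fin (s + 1) → V) =
      insert v (Finset.univ.image j) := by
    ext w; simp [Fin.exists_fin_succ, eq_comm]
  rw [h1]
  constructor
  · intro h
    have hv : v ∈ e := h ▸ Finset.mem_insert_self _ _
    have hn : v ∉ Finset.univ.image j := by
      intro hv'
      rw [Finset.insert_eq_of_mem hv'] at h
      have := Finset.card_image_le (s := (Finset.univ : Finset (Fin s))) (f := j)
      rw [h, he] at this
      simp at this
    exact ⟨hv, by rw [← h, Finset.erase_insert hn]⟩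
  · rintro ⟨hv, h⟩
    rw [h, Finset.insert_erase hv]

theorem sum_fin_cons {V : Type*} [Fintype V] {R : Type*} [AddCommMonoid R] {s : ℕ}
    (g : (Fin (s + 1) → V) → R) :
    ∑ i, g i = ∑ v, ∑ j : Fin s → V, g (Fin.cons v j) := by
  rw [← Fintype.sum_prod_type']
  exact (Fintype.sum_equiv (Fin.consEquiv fun _ => V) _ _ fun _ => rfl).symm

theorem sum_image_eq {V : Type*} [Fintype V] [DecidableEq V] {R : Type*} [CommRing R]
    (x : V → R) (s : ℕ) : ∀ e : Finset V, e.card = s →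
    (∑ j : Fin s → V, if Finset.univ.image j = e then ∏ k, x (j k) else 0) =
      (s.factorial : R) * ∏ v ∈ e, x v := by
  induction s with
  | zero =>
    intro e he
    rw [Finset.card_eq_zero] at he
    subst he
    simp
  | succ s ih =>
    intro e he
    rw [sum_fin_cons]
    simp only [image_cons_eq_iff he, Fin.prod_univ_succ, Fin.cons_zero, Fin.cons_succ]
    have : ∀ v, (∑ j : Fin s → V, if v ∈ e ∧ Finset.univ.image j = e.erase v then
        x v * ∏ k, x (j k) else 0) =
        if v ∈ e then (s.factorial : R) * ∏ v ∈ e, x v else 0 := by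
      intro v
      by_cases hv : v ∈ e
      · simp only [hv, true_and, if_true]
        have h2 := ih (e.erase v) (by rw [Finset.card_erase_of_mem hv, he]; rfl)
        rw [← Finset.mul_prod_erase e x hv, mul_left_comm, ← h2, Finset.mul_sum]
        exact Finset.sum_congr rfl fun j _ => by split_ifs <;> simp
      · simp [hv]
    simp only [this, Finset.sum_ite_mem, Finset.univ_inter, Finset.sum_const, he, nsmul_eq_mul,
      Nat.factorial_succ]
    push_cast; ring

/-- `P_H(x) = r ∑_{e ∈ E(H)} ∏_{v ∈ e} x_v`. -/
theorem polyForm_eq {V : Type*} [Fintype V] [DecidableEq V] {r : ℕ} (hr : 1 ≤ r)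
    (H : UniformHypergraph V r) (x : V → ℝ) :
    H.polyForm x = r * ∑ e ∈ H.edges, ∏ v ∈ e, x v := by
  have h1 : ∀ i : Fin r → V, H.adjTensor i * ∏ j, x (i j) = ∑ e ∈ H.edges,
      1 / ((r - 1).factorial : ℝ) * if Finset.univ.image i = e then ∏ j, x (i j) else 0 := by
    intro i
    rw [← Finset.mul_sum, Finset.sum_ite_eq, adjTensor]
    split_ifs <;> simp
  simp only [polyForm, h1]
  rw [Finset.sum_comm, Finset.mul_sum]
  refine Finset.sum_congr rfl fun e he => ?_
  rw [← Finset.mul_sum, sum_image_eq x r e (H.card_of_mem e he), ← mul_assoc]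
  congr 1
  obtain ⟨s, rfl⟩ : ∃ s, r = s + 1 := ⟨r - 1, by omega⟩
  have : (s.factorial : ℝ) ≠ 0 := by positivity
  simp [Nat.factorial_succ]
  field_simp

/-- The coordinates of the tensor-vector product occurring in the eigenvalue equation. -/
theorem tensorMul_eq {V : Type*} [Fintype V] [DecidableEq V] {r : ℕ} [NeZero r]
    (H : UniformHypergraph V r) (x : V → ℂ) (v : V) :
    ∑ i : Fin r → V with i 0 = v,
      (H.adjTensor i : ℂ) * ∏ j ∈ Finset.univ.erase 0, x (i j) =
    ∑ e ∈ H.edges with v ∈ e, ∏ u ∈ e.erase v, x u := by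
  obtain ⟨s, rfl⟩ : ∃ s, r = s + 1 := ⟨r - 1, by have := NeZero.pos r; omega⟩
  have hp : ∀ i : Fin (s + 1) → V,
      ∏ j ∈ Finset.univ.erase 0, x (i j) = ∏ k : Fin s, x (i k.succ) := by
    intro i
    rw [Fin.univ_succ, Finset.erase_cons, Finset.prod_map]; rfl
  have hs : (s.factorial : ℂ) ≠ 0 := by exact_mod_cast s.factorial_ne_zero
  rw [Finset.sum_filter, sum_fin_cons, Finset.sum_eq_single v (fun w _ hw => by simp [hw])
    (by simp)]
  simp only [Fin.cons_zero, if_true, hp, Fin.cons_succ]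
  have h1 : ∀ j : Fin s → V, (H.adjTensor (Fin.cons v j) : ℂ) * ∏ k, x (j k) =
      ∑ e ∈ H.edges, if v ∈ e then 1 / (s.factorial : ℂ) *
        (if Finset.univ.image j = e.erase v then ∏ k, x (j k) else 0) else 0 := by
    intro j
    have h2 : ∀ e ∈ H.edges, (if v ∈ e then 1 / (s.factorial : ℂ) *
        (if Finset.univ.image j = e.erase v then ∏ k, x (j k) else 0) else 0) =
        if Finset.univ.image (Fin.cons v j : Fin (s + 1) → V) = e then
          1 / (s.factorial : ℂ) * ∏ k, x (j k) else 0 := by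
      intro e he
      rw [if_congr (image_cons_eq_iff (H.card_of_mem e he) v j) rfl rfl, ite_and]
      split_ifs <;> simp
    rw [Finset.sum_congr rfl h2, Finset.sum_ite_eq, adjTensor]
    split_ifs <;> simp
  simp only [h1]
  rw [Finset.sum_comm, Finset.sum_filter]
  refine Finset.sum_congr rfl fun e he => ?_
  split_ifs with hv
  · rw [← Finset.mul_sum, sum_image_eq x s (e.erase v)
      (by rw [Finset.card_erase_of_mem hv, H.card_of_mem e he]; rfl)]
    field_simp
  · simp

theorem rNorm_eq_one_iff {V : Type*} [Fintype V] {r : ℕ} (hr : 1 ≤ r) (x : V → ℝ) :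
    rNorm r x = 1 ↔ ∑ v, |x v| ^ r = 1 := by
  have h0 : (0 : ℝ) ≤ ∑ v, |x v| ^ r := Finset.sum_nonneg fun _ _ => by positivity
  have hr' : (1 : ℝ) / r ≠ 0 := by positivity
  rw [rNorm, ← Real.rpow_left_inj h0 zero_le_one hr', Real.one_rpow]

/-- The maximum defining the spectral radius is attained. -/
theorem isGreatest_spectralRadius {V : Type*} [Fintype V] [DecidableEq V] [Nonempty V] {r : ℕ}
    (hr : 1 ≤ r) (H : UniformHypergraph V r) :
    IsGreatest {p : ℝ | ∃ x : V → ℝ, rNorm r x = 1 ∧ p = H.polyForm x} H.spectralRadius := by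
  have hset : {p : ℝ | ∃ x : V → ℝ, rNorm r x = 1 ∧ p = H.polyForm x} =
      H.polyForm '' {x | ∑ v, |x v| ^ r = 1} := by
    ext p
    simp only [rNorm_eq_one_iff hr, Set.mem_ofPred_eq, Set.mem_image, eq_comm]
  have hcl : IsClosed {x : V → ℝ | ∑ v, |x v| ^ r = 1} :=
    isClosed_eq (by fun_prop) continuous_const
  have hbd : Bornology.IsBounded {x : V → ℝ | ∑ v, |x v| ^ r = 1} := by
    refine (Metric.isBounded_closedBall (x := (0 : V → ℝ)) (r := 1)).subset fun x hx => ?_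
    rw [mem_closedBall_zero_iff, pi_norm_le_iff_of_nonneg zero_le_one]
    intro v
    rw [Real.norm_eq_abs]
    have h1 : |x v| ^ r ≤ 1 := by
      rw [← (show ∑ v, |x v| ^ r = 1 from hx)]
      exact Finset.single_le_sum (f := fun v => |x v| ^ r) (fun _ _ => by positivity)
        (Finset.mem_univ v)
    exact (pow_le_one_iff_of_nonneg (abs_nonneg _) (by omega)).1 h1
  have hne : {x : V → ℝ | ∑ v, |x v| ^ r = 1}.Nonempty := by
    obtain ⟨v₀⟩ := ‹Nonempty V›
    refine ⟨Pi.single v₀ 1, ?_⟩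
    simp only [Set.mem_ofPred_eq]
    rw [Finset.sum_eq_single v₀ (fun w _ hw => by simp [hw]; omega) (by simp)]
    simp
  have hcont : Continuous H.polyForm := by unfold polyForm; fun_prop
  rw [spectralRadius, hset]
  exact ((Metric.isCompact_of_isClosed_isBounded hcl hbd).image hcont).isGreatest_sSup
    (hne.image _)

/-- Homogeneous form of the maximality. -/
theorem polyForm_le {V : Type*} [Fintype V] [DecidableEq V] {r : ℕ}
    (hr : 1 ≤ r) (H : UniformHypergraph V r) (x : V → ℝ) :
    H.polyForm x ≤ H.spectralRadius * ∑ v, |x v| ^ r := by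
  by_cases hx : ∃ v, x v ≠ 0
  swap
  · push Not at hx
    have h1 : ∀ e ∈ H.edges, ∏ v ∈ e, x v = 0 := by
      intro e he
      obtain ⟨v, hv⟩ := Finset.card_pos.1 (by rw [H.card_of_mem e he]; omega : 0 < e.card)
      exact Finset.prod_eq_zero hv (hx v)
    rw [polyForm_eq hr, Finset.sum_eq_zero h1]
    simp [hx, show r ≠ 0 by omega]
  obtain ⟨v, hv⟩ := hx
  have : Nonempty V := ⟨v⟩
  set S := ∑ v, |x v| ^ r with hS
  have hSpos : 0 < S := Finset.sum_pos' (fun _ _ => by positivity)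
    ⟨v, Finset.mem_univ v, by positivity⟩
  set c : ℝ := S ^ (1 / (r : ℝ)) with hc
  have hcpos : 0 < c := Real.rpow_pos_of_pos hSpos _
  have hcr : c ^ r = S := by
    rw [hc, one_div, Real.rpow_inv_natCast_pow hSpos.le (by omega)]
  have hle := (isGreatest_spectralRadius hr H).2 ⟨fun v => x v / c, by
    rw [rNorm_eq_one_iff hr]
    simp only [abs_div, div_pow, abs_of_pos hcpos, hcr, ← Finset.sum_div]
    exact div_self hSpos.ne', rfl⟩
  have hh : H.polyForm (fun v => x v / c) = H.polyForm x / S := by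
    simp only [polyForm, Finset.prod_div_distrib, Finset.prod_const, Finset.card_univ,
      Fintype.card_fin, hcr, Finset.sum_div, mul_div_assoc]
  rw [hh, div_le_iff₀ hSpos] at hle
  exact hle

/-- The spectral radius is the largest modulus of the eigenvalues of the adjacency tensor. -/
theorem isGreatest_norm_eigenvalue {V : Type*} [Fintype V] [DecidableEq V] [Nonempty V] {r : ℕ}
    [NeZero r] (hr : 2 ≤ r) (H : UniformHypergraph V r) :
    IsGreatest {m : ℝ | ∃ lam : ℂ, H.IsEigenvalue lam ∧ m = ‖lam‖} H.spectralRadius := by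
  have hr1 : 1 ≤ r := by omega
  constructor
  · obtain ⟨y, hy, hyρ⟩ := (isGreatest_spectralRadius hr1 H).1
    rw [rNorm_eq_one_iff hr1] at hy
    set x : V → ℝ := fun v => |y v| with hxdef
    have hx0 : ∀ v, 0 ≤ x v := fun v => abs_nonneg _
    have hx : ∑ v, |x v| ^ r = 1 := by simpa [hxdef] using hy
    have hxρ : H.polyForm x = H.spectralRadius := by
      refine le_antisymm (by simpa [hx] using H.polyForm_le hr1 x) ?_
      rw [hyρ, polyForm_eq hr1, polyForm_eq hr1]
      refine mul_le_mul_of_nonneg_left (Finset.sum_le_sum fun e _ => ?_) (Nat.cast_nonneg r)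
      exact (le_abs_self (∏ v ∈ e, y v)).trans_eq (Finset.abs_prod e y)
    have hρ0 : 0 ≤ H.spectralRadius := by
      rw [← hxρ, polyForm_eq hr1]
      exact mul_nonneg (by positivity)
        (Finset.sum_nonneg fun e _ => Finset.prod_nonneg fun v _ => hx0 v)
    refine ⟨(H.spectralRadius : ℂ), ⟨fun v => (x v : ℂ), ?_, fun v => ?_⟩, ?_⟩
    · intro h0
      have h1 : ∀ v, x v = 0 := fun v => Complex.ofReal_eq_zero.1 (congrFun h0 v)
      simp [h1, show r ≠ 0 by omega] at hx
    · refine (H.tensorMul_eq (fun v => (x v : ℂ)) v).trans ?_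
      have key : ∑ e ∈ H.edges with v ∈ e, ∏ u ∈ e.erase v, x u =
          H.spectralRadius * x v ^ (r - 1) := by
        set D := ∑ e ∈ H.edges with v ∈ e, ∏ u ∈ e.erase v, x u with hD
        have hP : ∀ t : ℝ, H.polyForm (Function.update x v t) =
            H.polyForm x + r * D * (t - x v) := by
          intro t
          rw [polyForm_eq hr1, polyForm_eq hr1, hD, Finset.sum_filter, mul_assoc, ← mul_add,
            Finset.sum_mul, ← Finset.sum_add_distrib]
          congr 1
          refine Finset.sum_congr rfl fun e _ => ?_
          by_cases hv : v ∈ e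
          · rw [← Finset.mul_prod_erase e _ hv, ← Finset.mul_prod_erase e x hv]
            have : ∏ u ∈ e.erase v, Function.update x v t u = ∏ u ∈ e.erase v, x u :=
              Finset.prod_congr rfl fun u hu => by
                rw [Function.update_of_ne (Finset.ne_of_mem_erase hu)]
            rw [this, if_pos hv, Function.update_self]; ring
          · rw [if_neg hv, zero_mul, add_zero]
            refine Finset.prod_congr rfl fun u hu => ?_
            rw [Function.update_of_ne]
            rintro rfl; exact hv hu
        have hN : ∀ t : ℝ, ∑ u, |Function.update x v t u| ^ r = 1 - |x v| ^ r + |t| ^ r := by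
          intro t
          rw [← hx, ← Finset.add_sum_erase _ _ (Finset.mem_univ v),
            ← Finset.add_sum_erase _ (fun u => |x u| ^ r) (Finset.mem_univ v),
            Function.update_self]
          have : ∑ u ∈ Finset.univ.erase v, |Function.update x v t u| ^ r =
              ∑ u ∈ Finset.univ.erase v, |x u| ^ r :=
            Finset.sum_congr rfl fun u hu => by
              rw [Function.update_of_ne (Finset.ne_of_mem_erase hu)]
          rw [this]; ring
        have hmin : IsLocalMin (fun t : ℝ =>
            H.spectralRadius * |t| ^ (r : ℝ) - r * D * (t - x v)) (x v) := by
          refine Filter.Eventually.of_forall fun t => ?_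
          have h1 := H.polyForm_le hr1 (Function.update x v t)
          rw [hP, hN, hxρ] at h1
          simp only [Real.rpow_natCast]
          linarith
        have hd : HasDerivAt (fun t : ℝ =>
            H.spectralRadius * |t| ^ (r : ℝ) - r * D * (t - x v))
            (H.spectralRadius * ((r : ℝ) * |x v| ^ ((r : ℝ) - 2) * x v) - r * D * 1) (x v) :=
          ((hasDerivAt_abs_rpow (x v) (by exact_mod_cast hr)).const_mul _).sub
            (((hasDerivAt_id (x v)).sub_const _).const_mul _)
        have h0 := hmin.hasDerivAt_eq_zero hd
        have hpow : |x v| ^ ((r : ℝ) - 2) * x v = x v ^ (r - 1) := by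
          rw [abs_of_nonneg (hx0 v), show (r : ℝ) - 2 = ((r - 2 : ℕ) : ℝ) by
            rw [Nat.cast_sub hr]; norm_num, Real.rpow_natCast, ← pow_succ]
          congr 1; omega
        have hrpos : (r : ℝ) ≠ 0 := by positivity
        rw [mul_assoc (r : ℝ), hpow] at h0
        have : (r : ℝ) * (H.spectralRadius * x v ^ (r - 1) - D) = 0 := by linarith
        rcases mul_eq_zero.1 this with h | h
        · exact absurd h hrpos
        · linarith
      beta_reduce
      exact_mod_cast congrArg (fun z : ℝ => (z : ℂ)) key
    · rw [Complex.norm_real, Real.norm_of_nonneg hρ0]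
  · rintro m ⟨lam, ⟨x, hx0, hx⟩, rfl⟩
    set z : V → ℝ := fun v => ‖x v‖ with hz
    have h1 : ∀ v, ‖lam‖ * z v ^ r ≤ ∑ e ∈ H.edges, if v ∈ e then ∏ u ∈ e, z u else 0 := by
      intro v
      have h2 := hx v
      rw [tensorMul_eq] at h2
      have h3 : ‖lam‖ * z v ^ (r - 1) ≤ ∑ e ∈ H.edges with v ∈ e, ∏ u ∈ e.erase v, z u := by
        calc ‖lam‖ * z v ^ (r - 1) = ‖lam * x v ^ (r - 1)‖ := by simp [hz]
          _ = _ := by rw [← h2]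
          _ ≤ _ := by
            refine (norm_sum_le _ _).trans_eq ?_
            simp [hz, norm_prod]
      calc ‖lam‖ * z v ^ r = z v * (‖lam‖ * z v ^ (r - 1)) := by
            rw [mul_left_comm, mul_pow_sub_one (by omega)]
        _ ≤ z v * ∑ e ∈ H.edges with v ∈ e, ∏ u ∈ e.erase v, z u :=
            mul_le_mul_of_nonneg_left h3 (norm_nonneg _)
        _ = _ := by
            rw [Finset.mul_sum, Finset.sum_filter]
            refine Finset.sum_congr rfl fun e _ => ?_
            split_ifs with hv
            · exact Finset.mul_prod_erase e z hv
            · rfl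
    have h4 : ‖lam‖ * ∑ v, z v ^ r ≤ H.polyForm z := by
      rw [Finset.mul_sum]
      refine (Finset.sum_le_sum fun v _ => h1 v).trans_eq ?_
      rw [Finset.sum_comm, polyForm_eq hr1, Finset.mul_sum]
      refine Finset.sum_congr rfl fun e he => ?_
      rw [Finset.sum_ite_mem, Finset.univ_inter, Finset.sum_const, H.card_of_mem e he,
        nsmul_eq_mul]
    have h5 := H.polyForm_le hr1 z
    have h6 : ∑ v, |z v| ^ r = ∑ v, z v ^ r := by simp [hz]
    have hpos : 0 < ∑ v, z v ^ r := by
      obtain ⟨v, hv⟩ := Function.ne_iff.1 hx0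
      refine Finset.sum_pos' (fun _ _ => by positivity) ⟨v, Finset.mem_univ v, ?_⟩
      exact pow_pos (norm_pos_iff.2 hv) r
    rw [h6] at h5
    exact le_of_mul_le_mul_right (h4.trans h5) hpos

end UniformHypergraph

/-! ### Gibbs' inequality and an entropy inequality for exchangeable pairs -/

/-! The proof is by entropy. Take a nonnegative maximiser `x` with `∑ x_v ^ r = 1`, choose an edge
`e` with probability proportional to `∏_{v ∈ e} x_v`, and order its vertices at random as `X_1, …,
X_r`. Let `a_k = exp H(X_{k+1} | X_1, …, X_k)`, for `0 ≤ k < r`, and write `e = p_r(s)` for the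
number of edges.

Three facts carry the bound. The ordered edge takes at most `r! e` values, so `a_0 ⋯ a_{r-1} ≤ r! e
= s (s - 1) ⋯ (s - r + 1)`. Each step loses at least one: `a_{k+1} + 1 ≤ a_k`
(`exp_condEntropy_add_one_le`), an entropy version of the fact that the next vertex must avoid the
one just drawn. Comparing the law of `X_1` with the distribution `x_v ^ r` gives `(r - 1)! ρ ≤ a_1 ⋯
a_{r-1}` (`tupleEntropy_one_add_le`). The first two force `a_1 ⋯ a_{r-1} ≤ (s - 1) ⋯ (s - r + 1)`
(`prod_succ_le_of_add_one_le`), which is the claim.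

If equality holds, then `a_0 = s`, `a_1 = s - 1` and every edge has positive probability. The
equality case of the entropy inequality makes `X_1` uniform on its support `S`, so `s = |S|` and the
edges are all the `r`-subsets of `S`. Conversely, the indicator vector of the nonisolated vertices
attains the bound. -/

theorem negMulLog_add_mul_log_le {a b : ℝ} (ha : 0 ≤ a) (hb : 0 ≤ b) (hab : b = 0 → a = 0) :
    Real.negMulLog a + a * Real.log b ≤ b - a := by
  rcases ha.eq_or_lt with rfl | ha
  · simpa using hb
  have hb' : 0 < b := hb.lt_of_ne fun h => ha.ne' (hab h.symm)
  have h := Real.log_le_sub_one_of_pos (div_pos hb' ha)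
  rw [Real.log_div hb'.ne' ha.ne'] at h
  have h2 := mul_le_mul_of_nonneg_left h ha.le
  rw [mul_sub, mul_sub, mul_div_cancel₀ _ ha.ne'] at h2
  rw [Real.negMulLog]
  linarith

/-- Strictness of `log t < t - 1` away from `t = 1`, taken at `t = b / a`. As in the inequality,
`hab` is absolute continuity: without it the convention `Real.log 0 = 0` would hide an infinite
divergence. -/
theorem eq_of_negMulLog_add_mul_log_eq {a b : ℝ} (ha : 0 ≤ a) (hb : 0 ≤ b)
    (hab : b = 0 → a = 0) (h : Real.negMulLog a + a * Real.log b = b - a) : a = b := by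
  rcases ha.eq_or_lt with rfl | ha
  · simpa using h
  have hb' : 0 < b := hb.lt_of_ne fun h => ha.ne' (hab h.symm)
  by_contra hne
  have h1 := Real.log_lt_sub_one_of_pos (div_pos hb' ha)
    (fun h => hne ((div_eq_one_iff_eq ha.ne').1 h).symm)
  rw [Real.log_div hb'.ne' ha.ne'] at h1
  have h2 := mul_lt_mul_of_pos_left h1 ha
  rw [mul_sub, mul_sub, mul_div_cancel₀ _ ha.ne'] at h2
  rw [Real.negMulLog] at h
  linarith

/-- Let `m` be the joint law of `(W, X, Y)`, exchangeable in `(X, Y)`, with `X ≠ Y` almost surely.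
Then `exp H(Y | W, X) + 1 ≤ exp H(X | W)`, and in the case of equality the law of `X` given `W` is
uniform on its support. -/
theorem exp_condEntropy_add_one_le {W V : Type*} [Fintype W] [Fintype V] [DecidableEq V]
    (m : W → V → V → ℝ) (m₂ : W → V → ℝ) (m₁ : W → ℝ)
    (hm : ∀ w x y, 0 ≤ m w x y) (hsymm : ∀ w x y, m w x y = m w y x) (hdiag : ∀ w x, m w x x = 0)
    (hm₂ : ∀ w x, ∑ y, m w x y = m₂ w x) (hm₁ : ∀ w, ∑ x, m₂ w x = m₁ w) (hone : ∑ w, m₁ w = 1)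
    {H₁ H₂ H₃ : ℝ} (hH₁ : H₁ = ∑ w, Real.negMulLog (m₁ w))
    (hH₂ : H₂ = ∑ w, ∑ x, Real.negMulLog (m₂ w x))
    (hH₃ : H₃ = ∑ w, ∑ x, ∑ y, Real.negMulLog (m w x y)) :
    Real.exp (H₃ - H₂) + 1 ≤ Real.exp (H₂ - H₁) ∧
    (Real.exp (H₃ - H₂) + 1 = Real.exp (H₂ - H₁) →
      ∀ w x, m₂ w x ≠ 0 → m₂ w x * Real.exp (H₂ - H₁) = m₁ w) := by
  have h2 : ∀ w x, 0 ≤ m₂ w x := fun w x => hm₂ w x ▸ Finset.sum_nonneg fun y _ => hm w x y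
  have h1 : ∀ w, 0 ≤ m₁ w := fun w => hm₁ w ▸ Finset.sum_nonneg fun x _ => h2 w x
  have h12 : ∀ w x, m₁ w = 0 → m₂ w x = 0 := fun w x h =>
    le_antisymm (h ▸ hm₁ w ▸ Finset.single_le_sum (f := m₂ w) (fun x _ => h2 w x)
      (Finset.mem_univ x)) (h2 w x)
  have h23 : ∀ w x y, m₂ w x = 0 → m w x y = 0 := fun w x y h =>
    le_antisymm (h ▸ hm₂ w x ▸ Finset.single_le_sum (f := m w x) (fun y _ => hm w x y)
      (Finset.mem_univ y)) (hm w x y)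
  have h23' : ∀ w x y, m₂ w y = 0 → m w x y = 0 := fun w x y h => by rw [hsymm, h23 w y x h]
  -- Mix the law of `(W, X, X)` with weight `p` and that of `(W, X, Y)` with weight `q`; they have
  -- disjoint supports since `X ≠ Y`. Gibbs' inequality compares the mixture with the law `m₂ w x *
  -- m₂ w y / m₁ w`, under which `X` and `Y` are conditionally independent given `W`. Both have the
  -- marginals of `(W, X)` and `(W, Y)`, so the outcome involves only `H₁`, `H₂`, `H₃`. The weights
  -- `1 : c` maximise the entropy of the mixture, whence the term `log (1 + c)`.
  set c := Real.exp (H₃ - H₂) with hc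
  have hc0 : 0 < c := Real.exp_pos _
  set p := 1 / (1 + c) with hp
  set q := c / (1 + c) with hq
  have hp0 : 0 < p := by positivity
  have hq0 : 0 < q := by positivity
  have hpq : p + q = 1 := by rw [hp, hq]; field_simp
  have hlp : Real.log p = - Real.log (1 + c) := by rw [hp, one_div, Real.log_inv]
  have hlq : Real.log q = H₃ - H₂ - Real.log (1 + c) := by
    rw [hq, Real.log_div hc0.ne' (by positivity), hc, Real.log_exp]
  -- termwise Gibbs inequalities
  have hbd : ∀ w x, m₂ w x ^ 2 / m₁ w = 0 → p * m₂ w x = 0 := by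
    intro w x h
    rcases div_eq_zero_iff.1 h with h | h
    · rw [pow_eq_zero_iff two_ne_zero] at h; simp [h]
    · simp [h12 w x h]
  have hbo : ∀ w x y, (if x = y then 0 else m₂ w x * m₂ w y / m₁ w) = 0 → q * m w x y = 0 := by
    intro w x y h
    split_ifs at h with hxy
    · simp [hxy, hdiag]
    · rcases div_eq_zero_iff.1 h with h | h
      · rcases mul_eq_zero.1 h with h | h
        · simp [h23 w x y h]
        · simp [h23' w x y h]
      · simp [h23 w x y (h12 w x h)]
  have hbo0 : ∀ w x y, 0 ≤ (if x = y then 0 else m₂ w x * m₂ w y / m₁ w) := by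
    intro w x y
    split_ifs
    · exact le_rfl
    · exact div_nonneg (mul_nonneg (h2 _ _) (h2 _ _)) (h1 _)
  have gd : ∀ w x, p * (m₂ w x * (-Real.log p) - Real.negMulLog (m₂ w x)
      - m₂ w x * Real.log (m₁ w)) =
      Real.negMulLog (p * m₂ w x) + p * m₂ w x * Real.log (m₂ w x ^ 2 / m₁ w) := by
    intro w x
    by_cases h : m₂ w x = 0
    · simp [h]
    · have h' : m₁ w ≠ 0 := fun h0 => h (h12 w x h0)
      rw [Real.log_div (pow_ne_zero _ h) h', Real.log_pow, Real.negMulLog, Real.negMulLog,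
        Real.log_mul hp0.ne' h]
      push_cast; ring
  have go : ∀ w x y, q * (m w x y * (-Real.log q) + Real.negMulLog (m w x y)
      + m w x y * Real.log (m₂ w x) + m w x y * Real.log (m₂ w y) - m w x y * Real.log (m₁ w)) =
      Real.negMulLog (q * m w x y) +
        q * m w x y * Real.log (if x = y then 0 else m₂ w x * m₂ w y / m₁ w) := by
    intro w x y
    by_cases h : m w x y = 0
    · simp [h]
    · have hxy : x ≠ y := by rintro rfl; exact h (hdiag w x)
      have hx : m₂ w x ≠ 0 := fun h0 => h (h23 w x y h0)
      have hy : m₂ w y ≠ 0 := fun h0 => h (h23' w x y h0)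
      have h' : m₁ w ≠ 0 := fun h0 => hx (h12 w x h0)
      rw [if_neg hxy, Real.log_div (mul_ne_zero hx hy) h', Real.log_mul hx hy, Real.negMulLog,
        Real.negMulLog, Real.log_mul hq0.ne' h]
      ring
  have sd : ∀ w x, p * (m₂ w x * (-Real.log p) - Real.negMulLog (m₂ w x)
      - m₂ w x * Real.log (m₁ w)) ≤ m₂ w x ^ 2 / m₁ w - p * m₂ w x := by
    intro w x
    rw [gd]
    exact negMulLog_add_mul_log_le (mul_nonneg hp0.le (h2 w x))
      (div_nonneg (sq_nonneg _) (h1 w)) (hbd w x)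
  have so : ∀ w x y, q * (m w x y * (-Real.log q) + Real.negMulLog (m w x y)
      + m w x y * Real.log (m₂ w x) + m w x y * Real.log (m₂ w y) - m w x y * Real.log (m₁ w)) ≤
      (if x = y then 0 else m₂ w x * m₂ w y / m₁ w) - q * m w x y := by
    intro w x y
    rw [go]
    exact negMulLog_add_mul_log_le (mul_nonneg hq0.le (hm w x y)) (hbo0 w x y) (hbo w x y)
  -- evaluation of the sums
  have e1 : ∑ w, ∑ x, m₂ w x * Real.log (m₁ w) = -H₁ := by
    rw [hH₁, ← Finset.sum_neg_distrib]
    refine Finset.sum_congr rfl fun w _ => ?_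
    rw [← Finset.sum_mul, hm₁, Real.negMulLog]; ring
  have e2 : ∑ w, ∑ x, ∑ y, m w x y * Real.log (m₂ w x) = -H₂ := by
    rw [hH₂, ← Finset.sum_neg_distrib]
    refine Finset.sum_congr rfl fun w _ => ?_
    rw [← Finset.sum_neg_distrib]
    refine Finset.sum_congr rfl fun x _ => ?_
    rw [← Finset.sum_mul, hm₂, Real.negMulLog]; ring
  -- Exchangeability enters here: `Y` has the same conditional law as `X`.
  have e3 : ∑ w, ∑ x, ∑ y, m w x y * Real.log (m₂ w y) = -H₂ := by
    rw [← e2]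
    refine Finset.sum_congr rfl fun w _ => ?_
    rw [Finset.sum_comm]
    exact Finset.sum_congr rfl fun y _ => Finset.sum_congr rfl fun x _ => by rw [hsymm]
  have e4 : ∑ w, ∑ x, ∑ y, m w x y * Real.log (m₁ w) = -H₁ := by
    rw [← e1]
    refine Finset.sum_congr rfl fun w _ => Finset.sum_congr rfl fun x _ => ?_
    rw [← Finset.sum_mul, hm₂]
  have e5 : ∑ w, ∑ x, m₂ w x = 1 := by simp only [hm₁, hone]
  have e6 : ∑ w, ∑ x, ∑ y, m w x y = 1 := by simp only [hm₂, e5]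
  have ed : ∑ w, ∑ x, p * (m₂ w x * (-Real.log p) - Real.negMulLog (m₂ w x)
      - m₂ w x * Real.log (m₁ w)) = p * (-Real.log p - H₂ + H₁) := by
    simp only [← Finset.mul_sum, Finset.sum_sub_distrib, ← Finset.sum_mul, e5, ← hH₂]
    simp only [Finset.sum_mul, e1]
    ring
  have eo : ∑ w, ∑ x, ∑ y, q * (m w x y * (-Real.log q) + Real.negMulLog (m w x y)
      + m w x y * Real.log (m₂ w x) + m w x y * Real.log (m₂ w y) - m w x y * Real.log (m₁ w)) =
      q * (-Real.log q + H₃ - H₂ - H₂ + H₁) := by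
    simp only [← Finset.mul_sum, Finset.sum_sub_distrib, Finset.sum_add_distrib, e2, e3, e4, ← hH₃]
    simp only [← Finset.sum_mul, e6]
    ring
  -- The reference law and the mixture both have total mass one, so the right-hand sides of the
  -- Gibbs inequalities cancel.
  have eb : ∑ w, ∑ x, (m₂ w x ^ 2 / m₁ w - p * m₂ w x) +
      ∑ w, ∑ x, ∑ y, ((if x = y then 0 else m₂ w x * m₂ w y / m₁ w) - q * m w x y) = 0 := by
    have : ∀ w, ∑ x, m₂ w x ^ 2 / m₁ w +
        ∑ x, ∑ y, (if x = y then 0 else m₂ w x * m₂ w y / m₁ w) = m₁ w := by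
      intro w
      rw [← Finset.sum_add_distrib]
      have : ∀ x, m₂ w x ^ 2 / m₁ w + ∑ y, (if x = y then 0 else m₂ w x * m₂ w y / m₁ w) =
          m₂ w x := by
        intro x
        have h3 : ∀ y, (if x = y then 0 else m₂ w x * m₂ w y / m₁ w) =
            m₂ w x / m₁ w * m₂ w y - if x = y then m₂ w x ^ 2 / m₁ w else 0 := by
          intro y
          split_ifs with h
          · rw [← h]; ring
          · ring
        simp only [h3, Finset.sum_sub_distrib, ← Finset.mul_sum, hm₁, Finset.sum_ite_eq,
          Finset.mem_univ, if_true]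
        by_cases h : m₁ w = 0
        · simp [h, h12 w x h]
        · field_simp; ring
      simp only [this, hm₁]
    have h4 := Finset.sum_congr (rfl : (Finset.univ : Finset W) = _) fun w _ => this w
    rw [Finset.sum_add_distrib, hone] at h4
    simp only [Finset.sum_sub_distrib, ← Finset.mul_sum, e5, e6]
    linarith
  have key : p * (-Real.log p - H₂ + H₁) + q * (-Real.log q + H₃ - H₂ - H₂ + H₁) =
      Real.log (1 + c) - (H₂ - H₁) := by
    rw [hlp, hlq]
    linear_combination (Real.log (1 + c) - (H₂ - H₁)) * hpq
  have sdw : ∀ w, ∑ x, p * (m₂ w x * (-Real.log p) - Real.negMulLog (m₂ w x)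
      - m₂ w x * Real.log (m₁ w)) ≤ ∑ x, (m₂ w x ^ 2 / m₁ w - p * m₂ w x) :=
    fun w => Finset.sum_le_sum fun x _ => sd w x
  have Sd := Finset.sum_le_sum fun w (_ : w ∈ Finset.univ) => sdw w
  have So := Finset.sum_le_sum fun w (_ : w ∈ Finset.univ) =>
    Finset.sum_le_sum fun x (_ : x ∈ Finset.univ) =>
      Finset.sum_le_sum fun y (_ : y ∈ Finset.univ) => so w x y
  rw [eo] at So
  constructor
  · rw [ed] at Sd
    have : Real.log (1 + c) ≤ H₂ - H₁ := by linarith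
    rw [add_comm]
    exact (Real.log_le_iff_le_exp (by positivity)).1 this
  · intro heq w x hx
    have hlog : Real.log (1 + c) = H₂ - H₁ := by rw [add_comm, heq, Real.log_exp]
    -- Equality overall forces equality in every Gibbs term. The diagonal terms suffice: they give
    -- `p * m₂ w x = m₂ w x ^ 2 / m₁ w`, with `1 / p = 1 + c`.
    have hS : ∑ w, ∑ x, p * (m₂ w x * (-Real.log p) - Real.negMulLog (m₂ w x)
      - m₂ w x * Real.log (m₁ w)) = ∑ w, ∑ x, (m₂ w x ^ 2 / m₁ w - p * m₂ w x) := by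
      refine le_antisymm Sd ?_
      rw [ed]; linarith
    have hSw := (Finset.sum_eq_sum_iff_of_le fun w _ => sdw w).1 hS w (Finset.mem_univ w)
    have hSx := (Finset.sum_eq_sum_iff_of_le fun x _ => sd w x).1 hSw x (Finset.mem_univ x)
    rw [gd] at hSx
    have := eq_of_negMulLog_add_mul_log_eq (mul_nonneg hp0.le (h2 w x))
      (div_nonneg (sq_nonneg _) (h1 w)) (hbd w x) hSx
    have h' : m₁ w ≠ 0 := fun h0 => hx (h12 w x h0)
    rw [← heq]
    rw [hp] at this
    field_simp at this
    rw [mul_comm, add_comm]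
    exact this.symm

/-! ### The law of an initial segment of a random ordered edge -/

namespace UniformHypergraph

variable {V : Type*} [DecidableEq V] {r : ℕ}

/-- If an edge `e` is chosen with probability `q e` and its vertices are put in uniformly random
order, this is the probability that the first `k` vertices form the tuple `t`. -/
noncomputable def tupleLaw (H : UniformHypergraph V r) (q : Finset V → ℝ) (k : ℕ)
    (t : Fin k → V) : ℝ :=
  ∑ e ∈ H.edges, if Function.Injective t ∧ ∀ j, t j ∈ e then
    q e * ((r - k).factorial / r.factorial : ℝ) else 0

/-- The entropy of the first `k` vertices of a random ordered edge. -/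
noncomputable def tupleEntropy [Fintype V] (H : UniformHypergraph V r) (q : Finset V → ℝ)
    (k : ℕ) : ℝ :=
  ∑ t : Fin k → V, Real.negMulLog (H.tupleLaw q k t)

variable (H : UniformHypergraph V r) {q : Finset V → ℝ}

theorem tupleLaw_nonneg (hq : ∀ e, 0 ≤ q e) (k : ℕ) (t : Fin k → V) : 0 ≤ H.tupleLaw q k t := by
  refine Finset.sum_nonneg fun e _ => ?_
  split_ifs
  · exact mul_nonneg (hq e) (by positivity)
  · exact le_rfl

theorem injective_cons_and_iff {k : ℕ} (v : V) (t : Fin k → V) (e : Finset V) :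
    (Function.Injective (Fin.cons v t : Fin (k + 1) → V) ∧
      ∀ j, (Fin.cons v t : Fin (k + 1) → V) j ∈ e) ↔
    (Function.Injective t ∧ ∀ j, t j ∈ e) ∧ v ∈ e \ Finset.univ.image t := by
  rw [Fin.cons_injective_iff, Fin.forall_fin_succ]
  simp only [Fin.cons_zero, Fin.cons_succ, Set.mem_range, Finset.mem_sdiff, Finset.mem_image,
    Finset.mem_univ, true_and]
  tauto

/-- Inside a given edge, `t` extends by any of the `r - k` unused vertices, and `(r - k) * (r - k -
1)! = (r - k)!`. New vertices are prepended, so the tail `t` is the past. -/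
theorem sum_tupleLaw_cons [Fintype V] {k : ℕ} (hk : k < r) (t : Fin k → V) :
    ∑ v, H.tupleLaw q (k + 1) (Fin.cons v t) = H.tupleLaw q k t := by
  unfold tupleLaw
  rw [Finset.sum_comm]
  refine Finset.sum_congr rfl fun e he => ?_
  simp only [injective_cons_and_iff, ite_and (Function.Injective t ∧ ∀ j, t j ∈ e)]
  split_ifs with h
  · have hsub : Finset.univ.image t ⊆ e := by
      intro v hv
      obtain ⟨j, -, rfl⟩ := Finset.mem_image.1 hv
      exact h.2 j
    rw [Finset.sum_ite_mem, Finset.univ_inter, Finset.sum_const, Finset.card_sdiff_of_subset hsub,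
      Finset.card_image_of_injective _ h.1, H.card_of_mem e he, Finset.card_univ, Fintype.card_fin,
      nsmul_eq_mul]
    obtain ⟨d, rfl⟩ : ∃ d, r = k + d + 1 := ⟨r - k - 1, by omega⟩
    rw [show k + d + 1 - k = d + 1 by omega, show k + d + 1 - (k + 1) = d by omega,
      Nat.factorial_succ d]
    push_cast; ring
  · simp

theorem tupleLaw_cons_cons_comm {k : ℕ} (x y : V) (t : Fin k → V) :
    H.tupleLaw q (k + 2) (Fin.cons x (Fin.cons y t)) =
      H.tupleLaw q (k + 2) (Fin.cons y (Fin.cons x t)) := by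
  unfold tupleLaw
  refine Finset.sum_congr rfl fun e _ => if_congr ?_ rfl rfl
  have h : ∀ y : V, Finset.univ.image (Fin.cons y t : Fin (k + 1) → V) =
      insert y (Finset.univ.image t) := by
    intro y
    ext w; simp [Fin.exists_fin_succ, eq_comm]
  simp only [injective_cons_and_iff (k := k + 1), injective_cons_and_iff (k := k), h,
    Finset.mem_sdiff, Finset.mem_insert, not_or, eq_comm (a := x) (b := y)]
  tauto

theorem tupleLaw_cons_cons_self {k : ℕ} (x : V) (t : Fin k → V) :
    H.tupleLaw q (k + 2) (Fin.cons x (Fin.cons x t)) = 0 := by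
  unfold tupleLaw
  refine Finset.sum_eq_zero fun e _ => if_neg fun h => ?_
  have := h.1 (show (Fin.cons x (Fin.cons x t) : Fin (k + 2) → V) 0 =
    (Fin.cons x (Fin.cons x t) : Fin (k + 2) → V) 1 from rfl)
  simp at this

theorem tupleLaw_zero (t : Fin 0 → V) : H.tupleLaw q 0 t = ∑ e ∈ H.edges, q e := by
  have : (r.factorial : ℝ) ≠ 0 := by positivity
  simp [tupleLaw, Function.injective_of_subsingleton, this]

theorem tupleLaw_one (hr : 1 ≤ r) (t : Fin 1 → V) :
    H.tupleLaw q 1 t = (∑ e ∈ H.edges with t 0 ∈ e, q e) / r := by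
  obtain ⟨s, rfl⟩ : ∃ s, r = s + 1 := ⟨r - 1, by omega⟩
  have : (s.factorial : ℝ) ≠ 0 := by positivity
  rw [tupleLaw, Finset.sum_filter, Finset.sum_div]
  refine Finset.sum_congr rfl fun e _ => ?_
  simp only [Function.injective_of_subsingleton, true_and, Fin.forall_fin_one, Nat.factorial_succ,
    Nat.add_sub_cancel]
  split_ifs
  · push_cast; field_simp
  · simp

theorem sum_tupleLaw [Fintype V] (hq : ∑ e ∈ H.edges, q e = 1) :
    ∀ k ≤ r, ∑ t, H.tupleLaw q k t = 1 := by
  intro k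
  induction k with
  | zero => intro _; simp [tupleLaw_zero, hq]
  | succ k ih =>
    intro hk
    rw [sum_fin_cons, Finset.sum_comm]
    simp only [H.sum_tupleLaw_cons (q := q) (show k < r by omega)]
    exact ih (by omega)

/-- The entropy inequality with `W` the first `k` vertices and `X`, `Y` the next two: the random
order makes these exchangeable, and they are distinct. -/
theorem exp_tupleEntropy_add_one_le [Fintype V] (hq0 : ∀ e, 0 ≤ q e)
    (hq : ∑ e ∈ H.edges, q e = 1) {k : ℕ} (hk : k + 2 ≤ r) :
    Real.exp (H.tupleEntropy q (k + 2) - H.tupleEntropy q (k + 1)) + 1 ≤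
      Real.exp (H.tupleEntropy q (k + 1) - H.tupleEntropy q k) ∧
    (Real.exp (H.tupleEntropy q (k + 2) - H.tupleEntropy q (k + 1)) + 1 =
      Real.exp (H.tupleEntropy q (k + 1) - H.tupleEntropy q k) →
      ∀ t v, H.tupleLaw q (k + 1) (Fin.cons v t) ≠ 0 →
        H.tupleLaw q (k + 1) (Fin.cons v t) *
          Real.exp (H.tupleEntropy q (k + 1) - H.tupleEntropy q k) = H.tupleLaw q k t) := by
  refine exp_condEntropy_add_one_le
    (fun t x y => H.tupleLaw q (k + 2) (Fin.cons y (Fin.cons x t)))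
    (fun t x => H.tupleLaw q (k + 1) (Fin.cons x t)) (H.tupleLaw q k)
    (fun t x y => H.tupleLaw_nonneg hq0 _ _) (fun t x y => H.tupleLaw_cons_cons_comm _ _ _)
    (fun t x => H.tupleLaw_cons_cons_self _ _) (fun t x => H.sum_tupleLaw_cons (by omega) _)
    (fun t => H.sum_tupleLaw_cons (by omega) _) (H.sum_tupleLaw hq k (by omega)) rfl ?_ ?_
  · rw [tupleEntropy, sum_fin_cons, Finset.sum_comm]
  · rw [tupleEntropy, sum_fin_cons]
    simp only [sum_fin_cons (s := k)]
    rw [Finset.sum_comm, Finset.sum_congr rfl fun y _ => Finset.sum_comm, Finset.sum_comm]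

theorem injective_and_forall_mem_iff {t : Fin r → V} {e : Finset V} (he : e.card = r) :
    (Function.Injective t ∧ ∀ j, t j ∈ e) ↔ Finset.univ.image t = e := by
  constructor
  · rintro ⟨h1, h2⟩
    refine Finset.eq_of_subset_of_card_le (fun v hv => ?_) ?_
    · obtain ⟨j, -, rfl⟩ := Finset.mem_image.1 hv
      exact h2 j
    · rw [Finset.card_image_of_injective _ h1, he, Finset.card_univ, Fintype.card_fin]
  · rintro rfl
    refine ⟨?_, fun j => Finset.mem_image_of_mem t (Finset.mem_univ j)⟩
    have h := Finset.injOn_of_card_image_eq (s := Finset.univ) (f := t) (by rw [he]; simp)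
    rwa [Finset.coe_univ, Set.injOn_univ] at h

/-- An ordered edge is an edge together with an independent uniform choice among its `r!` orderings.
-/
theorem tupleEntropy_self [Fintype V] (hq : ∑ e ∈ H.edges, q e = 1) :
    H.tupleEntropy q r = ∑ e ∈ H.edges, Real.negMulLog (q e) + Real.log r.factorial := by
  have hr : (r.factorial : ℝ) ≠ 0 := by positivity
  have h1 : ∀ t : Fin r → V, Real.negMulLog (H.tupleLaw q r t) = ∑ e ∈ H.edges,
      if Finset.univ.image t = e then Real.negMulLog (q e / r.factorial) else 0 := by
    intro t
    have : H.tupleLaw q r t = ∑ e ∈ H.edges,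
        if Finset.univ.image t = e then q e / r.factorial else 0 := by
      refine Finset.sum_congr rfl fun e he => ?_
      rw [if_congr (injective_and_forall_mem_iff (H.card_of_mem e he)) rfl rfl, Nat.sub_self,
        Nat.factorial_zero, Nat.cast_one, mul_one_div]
    rw [this, Finset.sum_ite_eq, Finset.sum_ite_eq]
    split_ifs <;> simp
  have h2 : ∀ e ∈ H.edges, (∑ t : Fin r → V,
      if Finset.univ.image t = e then Real.negMulLog (q e / r.factorial) else 0) =
      Real.negMulLog (q e) + q e * Real.log r.factorial := by
    intro e he
    have h3 := sum_image_eq (fun _ : V => (1 : ℝ)) r e (H.card_of_mem e he)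
    simp only [Finset.prod_const_one, mul_one] at h3
    have h4 : ∀ t : Fin r → V,
        (if Finset.univ.image t = e then Real.negMulLog (q e / r.factorial) else 0) =
        (if Finset.univ.image t = e then 1 else 0) * Real.negMulLog (q e / r.factorial) := by
      intro t; split_ifs <;> simp
    simp only [h4]
    rw [← Finset.sum_mul, h3]
    by_cases h0 : q e = 0
    · simp [h0]
    · rw [Real.negMulLog, Real.negMulLog, Real.log_div h0 hr]
      field_simp; ring
  simp only [tupleEntropy, h1]
  rw [Finset.sum_comm, Finset.sum_congr rfl h2, Finset.sum_add_distrib, ← Finset.sum_mul, hq,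
    one_mul]

theorem tupleEntropy_zero [Fintype V] (hq : ∑ e ∈ H.edges, q e = 1) :
    H.tupleEntropy q 0 = 0 := by
  simp [tupleEntropy, tupleLaw_zero, hq]

end UniformHypergraph

/-! ### Two auxiliary estimates: entropy against support size, and products of decreasing sequences
-/

/-- Gibbs' inequality against the uniform law on the support. Counting the support instead of `s`
lets the equality case conclude that no edge has weight zero. -/
theorem sum_negMulLog_le_log_card {ι : Type*} (s : Finset ι) {q : ι → ℝ} (h0 : ∀ i, 0 ≤ q i)
    (h1 : ∑ i ∈ s, q i = 1) :
    ∑ i ∈ s, Real.negMulLog (q i) ≤ Real.log (s.filter fun i => q i ≠ 0).card := by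
  set T := s.filter fun i => q i ≠ 0 with hT
  have hT1 : ∑ i ∈ T, q i = 1 := by rw [hT, Finset.sum_filter_ne_zero, h1]
  have hTne : T.Nonempty := by
    rw [Finset.nonempty_iff_ne_empty]
    rintro h
    simp [h] at hT1
  have hc : (0 : ℝ) < T.card := by exact_mod_cast hTne.card_pos
  have h2 : ∑ i ∈ s, Real.negMulLog (q i) = ∑ i ∈ T, Real.negMulLog (q i) := by
    symm
    refine Finset.sum_subset (Finset.filter_subset _ _) fun i hi hi' => ?_
    have : q i = 0 := by
      by_contra h
      exact hi' (Finset.mem_filter.2 ⟨hi, h⟩)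
    simp [this]
  have h3 := Finset.sum_le_sum fun i (_ : i ∈ T) => negMulLog_add_mul_log_le (h0 i)
    (show (0 : ℝ) ≤ 1 / T.card by positivity) (fun h => absurd h (by positivity))
  rw [Finset.sum_add_distrib, ← Finset.sum_mul, Finset.sum_sub_distrib, hT1, Finset.sum_const,
    nsmul_eq_mul, mul_one_div_cancel hc.ne', one_div, Real.log_inv] at h3
  linarith

/-- If `a` decreases by at least one in every step and `∏_{j ≤ n} a j ≤ s (s - 1) ⋯ (s - n)`, then
`∏_{1 ≤ j ≤ n} a j ≤ (s - 1) ⋯ (s - n)`, with equality only if `a 0 = s` and `a 1 = s - 1`. -/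
theorem prod_succ_le_of_add_one_le {a : ℕ → ℝ} {n : ℕ} (hn : 1 ≤ n) {s : ℝ} (hs : (n : ℝ) < s)
    (hpos : ∀ k, 0 < a k) (ha : ∀ k < n, a (k + 1) + 1 ≤ a k)
    (h : a 0 * ∏ j ∈ Finset.range n, a (j + 1) ≤ s * ∏ j ∈ Finset.range n, (s - 1 - j)) :
    ∏ j ∈ Finset.range n, a (j + 1) ≤ ∏ j ∈ Finset.range n, (s - 1 - j) ∧
    (∏ j ∈ Finset.range n, a (j + 1) = ∏ j ∈ Finset.range n, (s - 1 - j) →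
      a 0 = s ∧ a 1 = s - 1) := by
  have h1 : ∀ j < n, a (j + 1) ≤ a 1 - j := by
    intro j
    induction j with
    | zero => intro _; simp
    | succ j ih =>
      intro hj
      have := ih (by omega)
      have := ha (j + 1) hj
      push_cast
      linarith
  have hlt : a 1 < s - 1 →
      ∏ j ∈ Finset.range n, a (j + 1) < ∏ j ∈ Finset.range n, (s - 1 - j) := by
    intro hlt
    refine Finset.prod_lt_prod_of_nonempty (fun j _ => hpos _) (fun j hj => ?_)
      ⟨0, Finset.mem_range.2 hn⟩
    linarith [h1 j (Finset.mem_range.1 hj)]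
  have hD : 0 < ∏ j ∈ Finset.range n, (s - 1 - j) := by
    refine Finset.prod_pos fun j hj => ?_
    have : ((j + 1 : ℕ) : ℝ) ≤ n := by exact_mod_cast Finset.mem_range.1 hj
    push_cast at this
    linarith
  have h01 := ha 0 hn
  rw [zero_add] at h01
  constructor
  -- A product that is too large forces `a 0 < s` by `h`, hence `a 1 < s - 1`, hence a product that
  -- is too small.
  · by_contra! hcon
    have h2 := (mul_lt_mul_of_pos_left hcon (hpos 0)).trans_le h
    have h3 := lt_of_mul_lt_mul_right h2 hD.le
    exact lt_asymm hcon (hlt (by linarith))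
  · intro heq
    rw [heq] at h
    have h2 := le_of_mul_le_mul_right h hD
    have h3 : ¬ a 1 < s - 1 := fun h4 => (hlt h4).ne heq
    constructor <;> linarith

/-! ### The bound on the polynomial form -/

namespace UniformHypergraph

variable {V : Type*} {r : ℕ} (H : UniformHypergraph V r)

/-- The probability distribution on the edges proportional to `∏_{v ∈ e} x_v`. -/
noncomputable def edgeWeight (x : V → ℝ) (e : Finset V) : ℝ :=
  (∏ v ∈ e, x v) / ∑ e' ∈ H.edges, ∏ v ∈ e', x v

variable {x : V → ℝ}

theorem sum_edgeWeight (hZ : 0 < ∑ e ∈ H.edges, ∏ v ∈ e, x v) :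
    ∑ e ∈ H.edges, H.edgeWeight x e = 1 := by
  simp only [edgeWeight]
  rw [← Finset.sum_div, div_self hZ.ne']

theorem edgeWeight_nonneg (hx : ∀ v, 0 ≤ x v) (e : Finset V) : 0 ≤ H.edgeWeight x e :=
  div_nonneg (Finset.prod_nonneg fun v _ => hx v)
    (Finset.sum_nonneg fun _ _ => Finset.prod_nonneg fun v _ => hx v)

variable [Fintype V] [DecidableEq V]

/-- The entropy of a random ordered edge of the weighted distribution, in terms of that of its first
vertex and of the polynomial form. -/
theorem tupleEntropy_one_add_le (hr : 1 ≤ r) (hx : ∀ v, 0 ≤ x v) (hx1 : ∑ v, x v ^ r = 1)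
    (hZ : 0 < ∑ e ∈ H.edges, ∏ v ∈ e, x v) :
    H.tupleEntropy (H.edgeWeight x) 1 + Real.log (∑ e ∈ H.edges, ∏ v ∈ e, x v) +
      Real.log r.factorial ≤ H.tupleEntropy (H.edgeWeight x) r := by
  rw [H.tupleEntropy_self (H.sum_edgeWeight hZ)]
  have hs1 := H.sum_edgeWeight hZ
  have hq0 := H.edgeWeight_nonneg hx
  have hr0 : (r : ℝ) ≠ 0 := by positivity
  have hne : ∀ e, H.edgeWeight x e ≠ 0 → ∀ v ∈ e, x v ≠ 0 := by
    intro e he v hv h0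
    exact he (by rw [edgeWeight, Finset.prod_eq_zero hv h0, zero_div])
  set Z := ∑ e ∈ H.edges, ∏ v ∈ e, x v with hZdef
  set q := H.edgeWeight x with hq
  set w : V → ℝ := fun v => (∑ e ∈ H.edges with v ∈ e, q e) / r with hw
  have hG1 : H.tupleEntropy q 1 = ∑ v, Real.negMulLog (w v) := by
    rw [tupleEntropy, sum_fin_cons]
    simp [tupleLaw_one H hr, hw]
  have hw1 : ∑ v, w v = 1 := by
    have h := H.sum_tupleLaw hs1 1 hr
    rw [sum_fin_cons] at h
    simpa [tupleLaw_one H hr, hw] using h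
  have hw0 : ∀ v, 0 ≤ w v := fun v =>
    div_nonneg (Finset.sum_nonneg fun e _ => hq0 e) (by positivity)
  -- Gibbs' inequality for the law `w` of the first vertex against `x v ^ r`. Absolute continuity
  -- holds because an edge through a zero of `x` has weight zero.
  have hg : ∀ v, Real.negMulLog (w v) + w v * Real.log (x v ^ r) ≤ x v ^ r - w v := by
    intro v
    refine negMulLog_add_mul_log_le (hw0 v) (pow_nonneg (hx v) r) fun h => ?_
    have hv := eq_zero_of_pow_eq_zero h
    rw [hw]
    simp only
    rw [Finset.sum_eq_zero, zero_div]
    intro e he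
    by_contra h0
    exact hne e h0 v (Finset.mem_filter.1 he).2 hv
  have hS := Finset.sum_le_sum fun v (_ : v ∈ Finset.univ) => hg v
  rw [Finset.sum_add_distrib, Finset.sum_sub_distrib, hx1, hw1, ← hG1] at hS
  have h1 : ∑ v, w v * Real.log (x v ^ r) = ∑ e ∈ H.edges, ∑ v ∈ e, q e * Real.log (x v) := by
    have : ∀ v, w v * Real.log (x v ^ r) =
        ∑ e ∈ H.edges, if v ∈ e then q e * Real.log (x v) else 0 := by
      intro v
      rw [← Finset.sum_filter, ← Finset.sum_mul, Real.log_pow, hw]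
      field_simp
    simp only [this]
    rw [Finset.sum_comm]
    exact Finset.sum_congr rfl fun e _ => by rw [Finset.sum_ite_mem, Finset.univ_inter]
  have h2 : ∀ e ∈ H.edges, Real.negMulLog (q e) =
      q e * Real.log Z - ∑ v ∈ e, q e * Real.log (x v) := by
    intro e _
    by_cases h0 : q e = 0
    · simp [h0]
    · have hv := hne e h0
      have hlog : Real.log (q e) = ∑ v ∈ e, Real.log (x v) - Real.log Z := by
        rw [hq, edgeWeight, Real.log_div (Finset.prod_ne_zero_iff.2 hv) hZ.ne', Real.log_prod hv]
      rw [Real.negMulLog, hlog, ← Finset.mul_sum]; ring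
  rw [Finset.sum_congr rfl h2, Finset.sum_sub_distrib, ← Finset.sum_mul, hs1, ← h1]
  linarith

/-- The bound `P_H(x) ≤ p_{r-1}(s - 1)`, where `p_r(s)` is the number of edges. -/
theorem polyForm_le_of_binomPoly_eq (hr : 2 ≤ r) (hx : ∀ v, 0 ≤ x v) (hx1 : ∑ v, x v ^ r = 1)
    {s : ℝ} (hs : (r : ℝ) - 1 < s) (hse : binomPoly r s = H.edges.card)
    (hZ : 0 < ∑ e ∈ H.edges, ∏ v ∈ e, x v) :
    H.polyForm x ≤ binomPoly (r - 1) (s - 1) ∧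
    (H.polyForm x = binomPoly (r - 1) (s - 1) →
      ∃ k : ℕ, H.edges.card = k.choose r ∧ H.IsCompleteWithIsolated k) := by
  obtain ⟨n, rfl⟩ : ∃ n, r = n + 1 := ⟨r - 1, by omega⟩
  have hn : 1 ≤ n := by omega
  have hs' : (n : ℝ) < s := by push_cast at hs; linarith
  have hq1 := H.sum_edgeWeight hZ
  have hq0 := H.edgeWeight_nonneg hx
  have hlow := H.tupleEntropy_one_add_le (by omega) hx hx1 hZ
  have hup := sum_negMulLog_le_log_card H.edges hq0 hq1
  have hself := H.tupleEntropy_self hq1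
  have hzero := H.tupleEntropy_zero hq1
  rw [polyForm_eq (by omega), Nat.add_sub_cancel]
  set Z := ∑ e ∈ H.edges, ∏ v ∈ e, x v with hZdef
  set q := H.edgeWeight x with hq
  set T := H.edges.filter fun e => q e ≠ 0 with hT
  set a : ℕ → ℝ := fun k => Real.exp (H.tupleEntropy q (k + 1) - H.tupleEntropy q k) with ha
  set B := ∏ j ∈ Finset.range n, a (j + 1) with hB
  have hBexp : B = Real.exp (H.tupleEntropy q (n + 1) - H.tupleEntropy q 1) := by
    rw [hB, ha]
    simp only
    rw [← Real.exp_sum, Finset.sum_range_sub (fun j => H.tupleEntropy q (j + 1))]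
  have haB : a 0 * B = Real.exp (H.tupleEntropy q (n + 1)) := by
    rw [hBexp, ha]
    simp only
    rw [← Real.exp_add, hzero]
    congr 1; ring
  have hTpos : 0 < T.card := by
    rw [Finset.card_pos, Finset.nonempty_iff_ne_empty]
    intro h
    have : ∑ e ∈ T, q e = 1 := by rw [hT, Finset.sum_filter_ne_zero, hq1]
    simp [h] at this
  have hTpos' : (0 : ℝ) < T.card := by exact_mod_cast hTpos
  have hTle : (T.card : ℝ) ≤ H.edges.card := by exact_mod_cast Finset.card_filter_le _ _
  have hfac : (0 : ℝ) < (n + 1).factorial := by positivity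
  have haT : a 0 * B ≤ (n + 1).factorial * T.card := by
    rw [haB, ← Real.le_log_iff_exp_le (by positivity), Real.log_mul hfac.ne' hTpos'.ne']
    linarith
  set D := ∏ j ∈ Finset.range n, (s - 1 - j) with hD
  -- The factor `j = 0` of `p_r(s)` is split off; the others form `D`.
  have hsD : s * D = (n + 1).factorial * H.edges.card := by
    rw [← hse, binomPoly, mul_div_cancel₀ _ hfac.ne', Finset.prod_range_succ', mul_comm, hD]
    congr 1
    · exact Finset.prod_congr rfl fun j _ => by push_cast; ring
    · simp
  have hZB : n.factorial * (((n + 1 : ℕ) : ℝ) * Z) ≤ B := by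
    rw [hBexp, ← Real.log_le_iff_le_exp (by positivity),
      show (n.factorial : ℝ) * (((n + 1 : ℕ) : ℝ) * Z) = (n + 1).factorial * Z by
        rw [Nat.factorial_succ]; push_cast; ring,
      Real.log_mul hfac.ne' hZ.ne']
    linarith
  obtain ⟨hBD, hBDeq⟩ := prod_succ_le_of_add_one_le (a := a) hn hs' (fun k => Real.exp_pos _)
    (fun k hk => (H.exp_tupleEntropy_add_one_le hq0 hq1 (k := k) (by omega)).1)
    (haT.trans (hsD ▸ mul_le_mul_of_nonneg_left hTle hfac.le))
  have hnf : (0 : ℝ) < n.factorial := by positivity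
  constructor
  · rw [binomPoly, le_div_iff₀ hnf, mul_comm]
    exact hZB.trans hBD
  intro heq
  rw [binomPoly, eq_div_iff hnf.ne', mul_comm] at heq
  have hBeq : B = D := le_antisymm hBD (heq.symm.le.trans hZB)
  obtain ⟨ha0, ha1⟩ := hBDeq hBeq
  -- With `a 0 * B = s * D`, the support bound leaves no room for an edge of weight zero.
  have hTcard : T = H.edges := by
    refine Finset.eq_of_subset_of_card_le (Finset.filter_subset _ _) ?_
    rw [ha0, hBeq, hsD] at haT
    exact_mod_cast le_of_mul_le_mul_left haT hfac
  -- At `k = 0` the past is empty, so equality makes the first vertex uniform on its support, each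
  -- value having probability `1 / s`; in particular `s` is an integer.
  have hunif := (H.exp_tupleEntropy_add_one_le hq0 hq1 (k := 0) (by omega)).2 (by
    change a 1 + 1 = a 0
    rw [ha0, ha1]; ring) Fin.elim0
  set w : V → ℝ := fun v => H.tupleLaw q 1 (Fin.cons v Fin.elim0) with hw
  have hws : ∀ v, w v ≠ 0 → w v * s = 1 := by
    intro v hv
    have := hunif v hv
    rw [tupleLaw_zero, hq1] at this
    rw [← ha0]
    exact this
  have hw1 : ∑ v, w v = 1 := by
    have h := H.sum_tupleLaw hq1 1 (by omega)
    rw [sum_fin_cons] at h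
    have h0 : ∀ t : Fin 0 → V, t = Fin.elim0 := fun t => Subsingleton.elim _ _
    simpa [h0] using h
  set S : Finset V := Finset.univ.filter fun v => w v ≠ 0 with hS
  have hScard : (S.card : ℝ) = s := by
    have h1 : ∑ v ∈ S, w v * s = s := by
      rw [← Finset.sum_mul, hS, Finset.sum_filter_ne_zero, hw1, one_mul]
    rw [← h1, Finset.sum_congr rfl fun v hv => hws v (Finset.mem_filter.1 hv).2,
      Finset.sum_const, nsmul_one]
  have hcard : H.edges.card = S.card.choose (n + 1) := by
    rw [← hScard, binomPoly_natCast] at hse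
    exact_mod_cast hse.symm
  -- Every edge has positive weight and so lies in `S`; counting then shows that all `r`-subsets of
  -- `S` occur.
  refine ⟨S.card, hcard, S, rfl, Finset.eq_of_subset_of_card_le (fun e he => ?_) ?_⟩
  · rw [Finset.mem_powersetCard]
    refine ⟨fun v hv => ?_, H.card_of_mem e he⟩
    rw [hS, Finset.mem_filter]
    refine ⟨Finset.mem_univ v, ?_⟩
    have hqe : 0 < q e := (hq0 e).lt_of_ne' (Finset.mem_filter.1 (hTcard ▸ he : e ∈ T)).2
    rw [hw]
    simp only
    rw [tupleLaw_one H (by omega)]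
    refine (div_pos (Finset.sum_pos' (fun e _ => hq0 e) ⟨e, ?_, hqe⟩) (by positivity)).ne'
    rw [Finset.mem_filter]
    exact ⟨he, hv⟩
  · rw [Finset.card_powersetCard, hcard]

/-! ### Edgeless and complete hypergraphs, and the conclusion -/

theorem spectralRadius_eq_zero_of_edges_eq_empty (hr : 1 ≤ r) (h : H.edges = ∅) :
    H.spectralRadius = 0 := by
  have h0 : ∀ x, H.polyForm x = 0 := fun x => by rw [polyForm_eq hr, h]; simp
  rcases isEmpty_or_nonempty V with hV | hV
  · have : {p : ℝ | ∃ x : V → ℝ, rNorm r x = 1 ∧ p = H.polyForm x} = ∅ := by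
      ext p
      simp [rNorm_eq_one_iff hr]
    rw [spectralRadius, this, Real.sSup_empty]
  · obtain ⟨x, -, hx⟩ := (isGreatest_spectralRadius hr H).1
    rw [hx, h0]

/-- Test with the indicator vector of `S`: the quotient is `r * C(k, r) / k = C(k - 1, r - 1)`. -/
theorem IsCompleteWithIsolated.choose_le_spectralRadius {k : ℕ} (hr : 1 ≤ r) (hk : 1 ≤ k)
    (h : H.IsCompleteWithIsolated k) : ((k - 1).choose (r - 1) : ℝ) ≤ H.spectralRadius := by
  obtain ⟨S, hS, hE⟩ := h
  obtain ⟨n, rfl⟩ : ∃ n, r = n + 1 := ⟨r - 1, by omega⟩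
  obtain ⟨m, rfl⟩ : ∃ m, k = m + 1 := ⟨k - 1, by omega⟩
  have h1 := H.polyForm_le hr (fun v => if v ∈ S then 1 else 0)
  rw [polyForm_eq hr] at h1
  have h2 : ∀ e ∈ H.edges, ∏ v ∈ e, (if v ∈ S then (1 : ℝ) else 0) = 1 := by
    intro e he
    rw [hE, Finset.mem_powersetCard] at he
    exact Finset.prod_eq_one fun v hv => if_pos (he.1 hv)
  have h3 : ∑ v, |if v ∈ S then (1 : ℝ) else 0| ^ (n + 1) = m + 1 := by
    have : ∀ v, |if v ∈ S then (1 : ℝ) else 0| ^ (n + 1) = if v ∈ S then 1 else 0 := by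
      intro v; split_ifs <;> simp
    simp only [this, Finset.sum_ite_mem, Finset.univ_inter, Finset.sum_const, hS]
    simp
  rw [Finset.sum_congr rfl h2, h3, Finset.sum_const, hE, Finset.card_powersetCard, hS,
    nsmul_one] at h1
  have h4 : ((m + 1 : ℕ) : ℝ) * m.choose n = (m + 1).choose (n + 1) * (n + 1 : ℕ) := by
    exact_mod_cast Nat.add_one_mul_choose_eq m n
  rw [mul_comm, ← h4, mul_comm] at h1
  push_cast at h1
  exact le_of_mul_le_mul_right h1 (by positivity)

end UniformHypergraph

theorem theorem1p2 {V : Type*} [Fintype V] [DecidableEq V] (r : ℕ) (hr : 2 ≤ r)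
    (H : UniformHypergraph V r) :
    H.spectralRadius ≤ stanleyF r H.edges.card ∧
    (H.spectralRadius = stanleyF r H.edges.card ↔
      ∃ k : ℕ, H.edges.card = k.choose r ∧ H.IsCompleteWithIsolated k) := by
  have hr1 : 1 ≤ r := by omega
  rcases H.edges.eq_empty_or_nonempty with hE | hE
  · have hρ := H.spectralRadius_eq_zero_of_edges_eq_empty hr1 hE
    have hf : stanleyF r H.edges.card = 0 := by
      -- `k = r - 1` is the left endpoint of the domain of `p_r`, where both binomial coefficients
      -- vanish.
      have h := stanleyF_choose (k := r - 1) hr (by omega)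
      rw [Nat.choose_eq_zero_of_lt (by omega), Nat.choose_eq_zero_of_lt (by omega)] at h
      simpa [hE] using h
    refine ⟨by rw [hρ, hf], fun _ => ⟨0, ?_, ∅, rfl, ?_⟩, fun _ => by rw [hρ, hf]⟩
    · rw [hE, Nat.choose_eq_zero_of_lt (by omega), Finset.card_empty]
    · rw [hE, Finset.powersetCard_eq_empty.2 (by simp; omega)]
  have hcard : (0 : ℝ) < H.edges.card := by exact_mod_cast hE.card_pos
  obtain ⟨e₀, he₀⟩ := hE
  obtain ⟨v₀, -⟩ := Finset.card_pos.1 (by rw [H.card_of_mem e₀ he₀]; omega : 0 < e₀.card)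
  have : Nonempty V := ⟨v₀⟩
  have hsurj := (bijOn_binomPoly hr1).surjOn (Set.mem_Ici.2 hcard.le)
  set s := binomPolyInv r H.edges.card with hs
  have hse : binomPoly r s = H.edges.card := Function.invFunOn_eq hsurj
  have hsr : (r : ℝ) - 1 ≤ s := Function.invFunOn_mem hsurj
  have hsr' : (r : ℝ) - 1 < s := by
    refine hsr.lt_of_ne fun h => ?_
    rw [← h, binomPoly, Finset.prod_eq_zero (i := r - 1) (Finset.mem_range.2 (by omega))
      (by rw [Nat.cast_sub hr1]; simp), zero_div] at hse
    exact hcard.ne hse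
  -- Taking absolute values keeps the norm and does not decrease the form, so some maximiser is
  -- nonnegative.
  have hmain : ∃ x : V → ℝ, (∀ v, 0 ≤ x v) ∧ ∑ v, x v ^ r = 1 ∧
      H.spectralRadius = H.polyForm x := by
    obtain ⟨y, hy, hyρ⟩ := (UniformHypergraph.isGreatest_spectralRadius hr1 H).1
    rw [UniformHypergraph.rNorm_eq_one_iff hr1] at hy
    refine ⟨fun v => |y v|, fun v => abs_nonneg _, hy, le_antisymm ?_ ?_⟩
    · rw [hyρ, UniformHypergraph.polyForm_eq hr1, UniformHypergraph.polyForm_eq hr1]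
      refine mul_le_mul_of_nonneg_left (Finset.sum_le_sum fun e _ => ?_) (Nat.cast_nonneg r)
      exact (le_abs_self (∏ v ∈ e, y v)).trans_eq (Finset.abs_prod e y)
    · simpa [hy] using H.polyForm_le hr1 fun v => |y v|
  obtain ⟨x, hx, hx1, hρ⟩ := hmain
  have hZ : 0 < ∑ e ∈ H.edges, ∏ v ∈ e, x v := by
    -- The all-ones vector shows that the spectral radius is positive once there is an edge.
    have h1 := H.polyForm_le hr1 fun _ => 1
    rw [UniformHypergraph.polyForm_eq hr1] at h1
    simp only [Finset.prod_const_one, Finset.sum_const, nsmul_one, abs_one, one_pow] at h1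
    have h2 : 0 < H.spectralRadius :=
      pos_of_mul_pos_left (lt_of_lt_of_le (by positivity) h1) (by positivity)
    rw [hρ, UniformHypergraph.polyForm_eq hr1] at h2
    exact pos_of_mul_pos_right h2 (by positivity)
  obtain ⟨hle, heq⟩ := H.polyForm_le_of_binomPoly_eq hr hx hx1 hsr' hse hZ
  rw [← hρ] at hle heq
  refine ⟨hle, heq, ?_⟩
  rintro ⟨k, hk, hcomp⟩
  refine le_antisymm hle ?_
  have hrk : r ≤ k := by
    by_contra! h
    rw [hk, Nat.choose_eq_zero_of_lt h] at hcard
    simp at hcard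
  rw [hk, stanleyF_choose hr (by omega)]
  exact hcomp.choose_le_spectralRadius H hr1 (by omega)
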